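/- Let $\mathbb D=\{z\in\mathbb C:|z|<1\}$. For $f$ holomorphic in $\mathbb D$ put $\widehat f_k=f^{(k)}(0)/k!$ and $\|f\|_\infty=\sup_{z\in\mathbb D}|f(z)|\in[0,\infty]$, and let $H^\infty$ be the set of all $f$ holomorphic in $\mathbb D$ with $\|f\|_\infty<\infty$. For $f,g$ holomorphic in $\mathbb D$ let $(f*g)(z)=\sum_{k=0}^\infty\widehat f_k\,\widehat g_k\,z^k$, $z\in\mathbb D$, be their Hadamard product. For $f\in H^\infty$ let $E_0(f)_\infty=\|f\|_\infty$ and, for $n\ge1$, let $E_n(f)_\infty=\inf_P\|f-P\|_\infty$, where $P$ runs over all complex algebraic polynomials of degree at most $n-1$. **Theorem.** Let $n\ge 0$ be an integer, and let $L_n$ be a holomorphic function in $\mathbb D$ such that $L_n(z)=O(z^n)$ as $z\to0$. Then $$|\widehat f_n|+\|L_n*f\|_\infty\le E_n(f)_\infty\quad\text{for all } f\in H^\infty$$ if and only if $|L_n(z)|\le\frac12|z|^{2n+1}$ for all $z\in\mathbb D$. -/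

import Mathlib

open Polynomial Topology Asymptotics
open scoped ENNReal

noncomputable section

/-- The `k`-th Taylor coefficient at the origin, `f^(k)(0) / k!`. -/
def taylorCoeff (f : ℂ → ℂ) (k : ℕ) : ℂ :=
  iteratedDeriv k f 0 / (Nat.factorial k : ℂ)

/-- The Hadamard product (convolution) of two functions holomorphic in the open unit disc:
the function whose Taylor coefficients are the products of the coefficients. The series
converges absolutely at every point of the open unit disc. -/
def hadamardProd (f g : ℂ → ℂ) (z : ℂ) : ℂ :=
  ∑' k : ℕ, taylorCoeff f k * taylorCoeff g k * z ^ k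

/-- The supremum of `|f|` over the open unit disc, as an extended nonnegative number
(it is `∞` exactly when `f` is unbounded on the disc). -/
def discSupNorm (f : ℂ → ℂ) : ℝ≥0∞ :=
  ⨆ z ∈ Metric.ball (0 : ℂ) 1, ‖f z‖ₑ

/-- The Hardy space `H^∞`: bounded holomorphic functions in the open unit disc. -/
def IsHInfty (f : ℂ → ℂ) : Prop :=
  DifferentiableOn ℂ f (Metric.ball (0 : ℂ) 1) ∧ discSupNorm f < ∞

/-- The best approximation of `f` in the supremum norm by polynomials of degree at most `n - 1`.
For `n = 0` the only polynomial of degree `< 0` is zero, and the value is the norm of `f`. -/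
def bestApprox (n : ℕ) (f : ℂ → ℂ) : ℝ≥0∞ :=
  ⨅ p ∈ Polynomial.degreeLT ℂ n, discSupNorm (fun z => f z - p.eval z)

theorem bestApprox_zero (f : ℂ → ℂ) : bestApprox 0 f = discSupNorm f := by
  have h : ∀ p : ℂ[X], p ∈ Polynomial.degreeLT ℂ 0 ↔ p = 0 := by
    intro p
    rw [Polynomial.mem_degreeLT]
    simp
  simp [bestApprox, h]

end

/-! Sufficiency is a duality argument. With `u` the boundary values of a dilate of `L`, the kernel
`e^{int} + u + e^{2int} conj u = e^{int}(1 + 2 Re(e^{-int}u))` has modulus `1 + 2 Re(e^{-int}u)`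
because `|u| ≤ 1/2`, hence mean modulus 1. Integrated against `g = f - p` it reproduces `g_n + ∑ L_k
g_k z^k`, and a rotation of `L` turns this into a sum of absolute values
(`norm_coeff_add_tsum_mul_le`, `norm_coeff_add_norm_tsum_mul_le`). Necessity comes from test
functions: `z^n` kills `L_n`, the perturbations `z^n + ε z^{n+k}` kill `L_{n+1}, ..., L_{2n}`, and
`z^n` times a Blaschke factor gives `|L| ≤ 1/2` (`norm_le_half_of_forall`). The Schwarz lemma then
supplies the factor `|z|^{2n+1}`. -/

open scoped ComplexConjugate

/-! ### Taylor coefficients and zeros at the origin -/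

theorem hasSum_taylorCoeff {f : ℂ → ℂ} (hf : DifferentiableOn ℂ f (Metric.ball (0 : ℂ) 1))
    {z : ℂ} (hz : ‖z‖ < 1) : HasSum (fun k => taylorCoeff f k * z ^ k) (f z) := by
  have h := Complex.hasSum_taylorSeries_on_ball hf (z := z) (by simpa using hz)
  refine h.congr_fun fun k => ?_
  simp only [taylorCoeff, smul_eq_mul, sub_zero]
  field_simp

theorem analyticAt_zero_of_differentiableOn_ball {f : ℂ → ℂ}
    (hf : DifferentiableOn ℂ f (Metric.ball (0 : ℂ) 1)) : AnalyticAt ℂ f 0 :=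
  hf.analyticAt (Metric.ball_mem_nhds 0 one_pos)

/-- Uniqueness of the Taylor expansion. -/
theorem taylorCoeff_eq_of_hasSum {f : ℂ → ℂ} {c : ℕ → ℂ}
    (h : ∀ z : ℂ, ‖z‖ < 1 → HasSum (fun k => c k * z ^ k) (f z)) (k : ℕ) :
    taylorCoeff f k = c k := by
  have hp : HasFPowerSeriesAt f (FormalMultilinearSeries.ofScalars ℂ c) 0 := by
    rw [hasFPowerSeriesAt_iff]
    filter_upwards [Metric.ball_mem_nhds (0 : ℂ) one_pos] with z hz
    simpa [mul_comm] using h z (by simpa using hz)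
  have hq := hp.analyticAt.hasFPowerSeriesAt
  have := congrArg (fun p => p.coeff k) (hq.eq_formalMultilinearSeries hp)
  simpa [taylorCoeff] using this

theorem taylorCoeff_eq_zero_iff {f : ℂ → ℂ} {k : ℕ} :
    taylorCoeff f k = 0 ↔ iteratedDeriv k f 0 = 0 := by
  simp [taylorCoeff, Nat.factorial_ne_zero]

/-- If the order `d` were below `m`, then `f / z^d` would be `O(z^{m-d})` and tend to 0, against its
nonzero value at 0. -/
theorem taylorCoeff_eq_zero_of_isBigO {f : ℂ → ℂ} (hf : AnalyticAt ℂ f 0) {m : ℕ}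
    (h : f =O[𝓝 0] fun z : ℂ => z ^ m) {k : ℕ} (hk : k < m) : taylorCoeff f k = 0 := by
  suffices hm : (m : ℕ∞) ≤ analyticOrderAt f 0 from
    taylorCoeff_eq_zero_iff.2 ((natCast_le_analyticOrderAt_iff_iteratedDeriv_eq_zero hf).1 hm k hk)
  by_contra! hlt
  obtain ⟨d, hd⟩ := ENat.ne_top_iff_exists.1 hlt.ne_top
  rw [← hd, Nat.cast_lt] at hlt
  obtain ⟨g, hg, hg0, hfg⟩ := hf.analyticOrderAt_eq_natCast.1 hd.symm
  have hgO : g =O[𝓝[≠] 0] fun z : ℂ => z ^ (m - d) := by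
    obtain ⟨C, hC⟩ := h.bound
    refine IsBigO.of_bound C ?_
    filter_upwards [nhdsWithin_le_nhds hC, nhdsWithin_le_nhds hfg, self_mem_nhdsWithin]
      with z h1 h2 h3
    have hz : 0 < ‖z‖ ^ d := pow_pos (norm_pos_iff.2 h3) d
    rw [h2, sub_zero, smul_eq_mul, norm_mul, norm_pow, norm_pow,
      ← Nat.add_sub_cancel' hlt.le, pow_add] at h1
    rw [norm_pow]
    exact le_of_mul_le_mul_left (by linarith) hz
  have hlim : Filter.Tendsto (fun z : ℂ => z ^ (m - d)) (𝓝[≠] 0) (𝓝 0) := by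
    have : ContinuousAt (fun z : ℂ => z ^ (m - d)) 0 := by fun_prop
    simpa [ContinuousAt, (Nat.sub_pos_of_lt hlt).ne'] using this.mono_left nhdsWithin_le_nhds
  exact hg0 (tendsto_nhds_unique (hg.continuousAt.mono_left nhdsWithin_le_nhds)
    (hgO.trans_tendsto hlim))

theorem isBigO_pow_of_taylorCoeff_eq_zero {f : ℂ → ℂ} (hf : AnalyticAt ℂ f 0) {m : ℕ}
    (h : ∀ k < m, taylorCoeff f k = 0) : f =O[𝓝 0] fun z : ℂ => z ^ m := by
  obtain ⟨g, hg, hfg⟩ := (natCast_le_analyticOrderAt hf).1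
    ((natCast_le_analyticOrderAt_iff_iteratedDeriv_eq_zero hf).2
      fun k hk => taylorCoeff_eq_zero_iff.1 (h k hk))
  have : (fun z : ℂ => z ^ m * g z) =O[𝓝 0] fun z : ℂ => z ^ m * 1 :=
    (isBigO_refl _ _).mul (hg.continuousAt.isBigO_one ℂ)
  simpa using this.congr' (by filter_upwards [hfg] with z hz; simp [hz]) Filter.EventuallyEq.rfl

/-- The Schwarz lemma for functions with a zero of higher order at the origin. -/
theorem norm_le_mul_pow_of_taylorCoeff_eq_zero {f : ℂ → ℂ}
    (hf : DifferentiableOn ℂ f (Metric.ball (0 : ℂ) 1)) {C : ℝ} {m : ℕ}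
    (hC : ∀ z ∈ Metric.ball (0 : ℂ) 1, ‖f z‖ ≤ C) (h : ∀ k < m + 1, taylorCoeff f k = 0)
    {z : ℂ} (hz : z ∈ Metric.ball (0 : ℂ) 1) : ‖f z‖ ≤ C * ‖z‖ ^ (m + 1) := by
  have hf0 : f 0 = 0 := by simpa [taylorCoeff] using h 0 m.succ_pos
  have hO := isBigO_pow_of_taylorCoeff_eq_zero (analyticAt_zero_of_differentiableOn_ball hf) h
  have ho : (fun w => f w - f 0) =o[𝓝 0] fun w : ℂ => ‖w - 0‖ ^ m := by
    simp only [hf0, sub_zero, ← norm_pow]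
    exact (hO.trans_isLittleO (isLittleO_pow_pow m.lt_succ_self)).norm_right
  simpa [hf0] using Complex.dist_le_mul_div_pow_of_mapsTo_ball_of_isLittleO (R₂ := C) hf
    (fun w hw => by simpa [hf0] using hC w hw) ho hz

/-! ### Trigonometric series on the circle -/

/-- The character `t ↦ exp (i m t)` of the circle. -/
noncomputable def circleChar (m : ℤ) (t : ℝ) : ℂ := Complex.exp ((m * t : ℝ) * Complex.I)

theorem norm_circleChar (m : ℤ) (t : ℝ) : ‖circleChar m t‖ = 1 :=
  Complex.norm_exp_ofReal_mul_I _

theorem circleChar_add (m k : ℤ) (t : ℝ) :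
    circleChar (m + k) t = circleChar m t * circleChar k t := by
  simp only [circleChar, ← Complex.exp_add]
  push_cast
  ring_nf

theorem circleChar_zero (t : ℝ) : circleChar 0 t = 1 := by simp [circleChar]

theorem conj_circleChar (m : ℤ) (t : ℝ) : conj (circleChar m t) = circleChar (-m) t := by
  simp only [circleChar, ← Complex.exp_conj, map_mul, Complex.conj_ofReal, Complex.conj_I]
  push_cast
  ring_nf

theorem circleChar_one_pow (k : ℕ) (t : ℝ) : circleChar 1 t ^ k = circleChar k t := by
  simp only [circleChar, ← Complex.exp_nat_mul]
  push_cast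
  ring_nf

theorem circleChar_neg_one_pow (k : ℕ) (t : ℝ) : circleChar (-1) t ^ k = circleChar (-k) t := by
  simp only [circleChar, ← Complex.exp_nat_mul]
  push_cast
  ring_nf

@[fun_prop]
theorem continuous_circleChar (m : ℤ) : Continuous (circleChar m) := by
  unfold circleChar
  fun_prop

theorem integral_circleChar (m : ℤ) :
    ∫ t in (0 : ℝ)..2 * Real.pi, circleChar m t = if m = 0 then (2 * Real.pi : ℂ) else 0 := by
  split_ifs with hm
  · subst hm
    simp [circleChar_zero]
  · have hc : (m * Complex.I : ℂ) ≠ 0 := by simp [hm]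
    have h := integral_exp_mul_complex (a := 0) (b := 2 * Real.pi) hc
    have h1 : Complex.exp (m * Complex.I * (2 * Real.pi : ℝ)) = 1 := by
      rw [← Complex.exp_int_mul_two_pi_mul_I m]
      push_cast
      ring_nf
    rw [h1] at h
    simp only [Complex.ofReal_zero, mul_zero, Complex.exp_zero, sub_self, zero_div] at h
    rw [← h]
    refine intervalIntegral.integral_congr fun t _ => ?_
    simp only [circleChar]
    push_cast
    ring_nf

theorem continuous_tsum_mul_circleChar {ι : Type*} {c : ι → ℂ} (hc : Summable fun i => ‖c i‖)
    (m : ι → ℤ) : Continuous fun t => ∑' i, c i * circleChar (m i) t :=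
  continuous_tsum (fun i => by fun_prop) hc fun i t => by simp [norm_circleChar]

/-- Termwise integration of an absolutely convergent trigonometric series. -/
theorem hasSum_integral_circleChar {ι : Type*} [Countable ι] {c : ι → ℂ}
    (hc : Summable fun i => ‖c i‖) (m : ι → ℤ) :
    HasSum (fun i => if m i = 0 then 2 * Real.pi * c i else 0)
      (∫ t in (0 : ℝ)..2 * Real.pi, ∑' i, c i * circleChar (m i) t) := by
  have h := intervalIntegral.hasSum_integral_of_dominated_convergence
    (μ := MeasureTheory.volume) (a := 0) (b := 2 * Real.pi)
    (F := fun i t => c i * circleChar (m i) t)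
    (f := fun t => ∑' i, c i * circleChar (m i) t) (fun i _ => ‖c i‖)
    (fun i => by
      have : Continuous fun t => c i * circleChar (m i) t := by fun_prop
      exact this.aestronglyMeasurable)
    (fun i => .of_forall fun t _ => by simp [norm_circleChar])
    (.of_forall fun t _ => hc) (by simp)
    (.of_forall fun t _ => (Summable.of_norm (by simpa [norm_circleChar] using hc)).hasSum)
  refine h.congr_fun fun i => ?_
  rw [intervalIntegral.integral_const_mul, integral_circleChar]
  split_ifs <;> ring

/-- Integration of the product of two absolutely convergent trigonometric series. -/
theorem hasSum_integral_mul_circleChar {a b : ℕ → ℂ} (ha : Summable fun k => ‖a k‖)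
    (hb : Summable fun k => ‖b k‖) (p q : ℕ → ℤ) :
    HasSum (fun i : ℕ × ℕ => if p i.1 + q i.2 = 0 then 2 * Real.pi * (a i.1 * b i.2) else 0)
      (∫ t in (0 : ℝ)..2 * Real.pi, (∑' k, a k * circleChar (p k) t) *
        ∑' k, b k * circleChar (q k) t) := by
  have h := hasSum_integral_circleChar (ι := ℕ × ℕ) (ha.mul_norm hb) fun i => p i.1 + q i.2
  convert h using 3 with t
  rw [tsum_mul_tsum_of_summable_norm (by simpa [norm_circleChar] using ha)
    (by simpa [norm_circleChar] using hb)]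
  refine tsum_congr fun i => ?_
  rw [circleChar_add]
  ring

/-! ### Sufficiency: the duality estimate -/

theorem norm_coeff_add_tsum_mul_le {a b : ℕ → ℂ} (ha : Summable fun k => ‖a k‖)
    (hb : Summable fun k => ‖b k‖) {n : ℕ} (ha0 : ∀ k < 2 * n + 1, a k = 0) {M : ℝ}
    (hu : ∀ ζ : ℂ, ‖ζ‖ = 1 → ‖∑' k, a k * ζ ^ k‖ ≤ 1 / 2)
    (hM : ∀ ζ : ℂ, ‖ζ‖ = 1 → ‖∑' k, b k * ζ ^ k‖ ≤ M) :
    ‖b n + ∑' k, a k * b k‖ ≤ M := by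
  set u : ℝ → ℂ := fun t => ∑' k : ℕ, a k * circleChar k t with hu_def
  set G : ℝ → ℂ := fun t => ∑' k : ℕ, b k * circleChar (-k) t with hG_def
  have hucont : Continuous u := continuous_tsum_mul_circleChar ha _
  have hGcont : Continuous G := continuous_tsum_mul_circleChar hb _
  have hub (t) : ‖u t‖ ≤ 1 / 2 := by
    simpa [hu_def, circleChar_one_pow] using hu (circleChar 1 t) (norm_circleChar 1 t)
  have hGb (t) : ‖G t‖ ≤ M := by
    simpa [hG_def, circleChar_neg_one_pow] using hM (circleChar (-1) t) (norm_circleChar _ t)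
  have I1 : ∫ t in (0 : ℝ)..2 * Real.pi, circleChar n t * G t = 2 * Real.pi * b n := by
    have h := hasSum_integral_circleChar hb fun k => (n - k : ℤ)
    have h2 := hasSum_single n (f := fun i : ℕ => if (n - i : ℤ) = 0 then 2 * Real.pi * b i else 0)
      fun k hk => if_neg (by omega)
    rw [sub_self, if_pos rfl] at h2
    rw [← h.unique h2]
    refine intervalIntegral.integral_congr fun t _ => ?_
    simp only [hG_def, ← tsum_mul_left]
    refine tsum_congr fun k => ?_
    rw [sub_eq_add_neg, circleChar_add]
    ring
  have I2 : ∫ t in (0 : ℝ)..2 * Real.pi, u t * G t = 2 * Real.pi * ∑' k, a k * b k := by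
    have h := hasSum_integral_mul_circleChar ha hb (fun k => k) fun k => -k
    -- Only the diagonal pairs have frequency zero.
    have hinj : Function.Injective fun k : ℕ => (k, k) := fun k l h => (Prod.ext_iff.1 h).1
    rw [← hinj.hasSum_iff] at h
    · rw [← tsum_mul_left, ← h.tsum_eq]
      exact tsum_congr fun k => by simp
    · rintro ⟨k, l⟩ hkl
      refine if_neg fun h0 => hkl ⟨k, ?_⟩
      simp only at h0
      ext <;> simp; omega
  -- The frequencies `2n - k - l` are all negative, since `a k` vanishes for `k ≤ 2n`.
  have I3 : ∫ t in (0 : ℝ)..2 * Real.pi, circleChar (2 * n) t * conj (u t) * G t = 0 := by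
    have h := hasSum_integral_mul_circleChar (a := fun k => conj (a k)) (by simpa using ha) hb
      (fun k => 2 * n - k) fun k => -k
    have h0 : (fun i : ℕ × ℕ => if (2 * n - i.1 : ℤ) + -i.2 = 0 then
        2 * Real.pi * (conj (a i.1) * b i.2) else 0) = fun _ => 0 := by
      ext i
      split_ifs with hi
      · rw [ha0 i.1 (by omega)]
        simp
      · rfl
    rw [h0] at h
    rw [← h.unique hasSum_zero]
    refine intervalIntegral.integral_congr fun t _ => ?_
    have hconj : circleChar (2 * n) t * conj (u t) =
        ∑' k : ℕ, conj (a k) * circleChar (2 * n - k) t := by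
      simp only [hu_def, Complex.conj_tsum, ← tsum_mul_left]
      refine tsum_congr fun k => ?_
      rw [sub_eq_add_neg, circleChar_add, map_mul, conj_circleChar]
      ring
    simp only [hconj, hG_def]
  -- This zero mean makes the modulus of the kernel integrate to exactly `2π`.
  have I4 : ∫ t in (0 : ℝ)..2 * Real.pi, circleChar (-n) t * u t = 0 := by
    have h := hasSum_integral_circleChar ha fun k => (-n + k : ℤ)
    have h0 : (fun i : ℕ => if (-n + i : ℤ) = 0 then 2 * Real.pi * a i else 0) = fun _ => 0 := by
      ext i
      split_ifs with hi
      · rw [ha0 i (by omega)]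
        simp
      · rfl
    rw [h0] at h
    rw [← h.unique hasSum_zero]
    refine intervalIntegral.integral_congr fun t _ => ?_
    simp only [hu_def, ← tsum_mul_left]
    refine tsum_congr fun k => ?_
    rw [circleChar_add]
    ring
  -- The bound `1/2` on `u` is what keeps the real factor nonnegative.
  have hw (t) : ‖circleChar n t + u t + circleChar (2 * n) t * conj (u t)‖ =
      1 + 2 * (circleChar (-n) t * u t).re := by
    have h1 : circleChar n t + u t + circleChar (2 * n) t * conj (u t) =
        circleChar n t * (1 + 2 * (circleChar (-n) t * u t).re : ℝ) := by
      have hn : circleChar n t * circleChar (-n) t = 1 := by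
        rw [← circleChar_add, add_neg_cancel, circleChar_zero]
      have h2 : ((2 * (circleChar (-n) t * u t).re : ℝ) : ℂ) =
          circleChar (-n) t * u t + circleChar n t * conj (u t) := by
        rw [← Complex.add_conj, map_mul, conj_circleChar, neg_neg]
      rw [Complex.ofReal_add, h2, two_mul, circleChar_add]
      push_cast
      linear_combination (-u t) * hn
    rw [h1, norm_mul, norm_circleChar, one_mul, Complex.norm_real, Real.norm_of_nonneg]
    have := Complex.abs_re_le_norm (circleChar (-n) t * u t)
    rw [norm_mul, norm_circleChar, one_mul] at this
    linarith [(abs_le.1 (this.trans (hub t))).1]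
  have hint : ∫ t in (0 : ℝ)..2 * Real.pi,
      (circleChar n t + u t + circleChar (2 * n) t * conj (u t)) * G t =
        2 * Real.pi * (b n + ∑' k, a k * b k) := by
    rw [mul_add, ← I1, ← I2, ← add_zero (_ + _), ← I3,
      ← intervalIntegral.integral_add, ← intervalIntegral.integral_add]
    · simp only [add_mul]
    all_goals exact Continuous.intervalIntegrable (by fun_prop) _ _
  have hre : ∫ t in (0 : ℝ)..2 * Real.pi, (circleChar (-n) t * u t).re = 0 := by
    have := intervalIntegral.intervalIntegral_re (𝕜 := ℂ) (μ := MeasureTheory.volume)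
      (f := fun t => circleChar (-n) t * u t) (a := 0) (b := 2 * Real.pi)
      (Continuous.intervalIntegrable (by fun_prop) _ _)
    simpa [I4] using this
  have hmain : ‖∫ t in (0 : ℝ)..2 * Real.pi,
      (circleChar n t + u t + circleChar (2 * n) t * conj (u t)) * G t‖ ≤ 2 * Real.pi * M := by
    calc _ ≤ ∫ t in (0 : ℝ)..2 * Real.pi, (1 + 2 * (circleChar (-n) t * u t).re) * M := by
          refine intervalIntegral.norm_integral_le_of_norm_le (by positivity)
            (.of_forall fun t _ => ?_) (Continuous.intervalIntegrable (by fun_prop) _ _)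
          rw [norm_mul, hw]
          refine mul_le_mul_of_nonneg_left (hGb t) ?_
          rw [← hw]
          positivity
      _ = 2 * Real.pi * M := by
          rw [intervalIntegral.integral_mul_const, intervalIntegral.integral_add,
            intervalIntegral.integral_const_mul, hre]
          · simp
          all_goals exact Continuous.intervalIntegrable (by fun_prop) _ _
  rw [hint, norm_mul] at hmain
  have hpi : ‖(2 * Real.pi : ℂ)‖ = 2 * Real.pi := by
    simp [abs_of_pos Real.pi_pos]
  rw [hpi] at hmain
  exact le_of_mul_le_mul_left hmain (by positivity)

theorem norm_coeff_add_norm_tsum_mul_le {a b : ℕ → ℂ} (ha : Summable fun k => ‖a k‖)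
    (hb : Summable fun k => ‖b k‖) {n : ℕ} (ha0 : ∀ k < 2 * n + 1, a k = 0) {M : ℝ}
    (hu : ∀ ζ : ℂ, ‖ζ‖ = 1 → ‖∑' k, a k * ζ ^ k‖ ≤ 1 / 2)
    (hM : ∀ ζ : ℂ, ‖ζ‖ = 1 → ‖∑' k, b k * ζ ^ k‖ ≤ M) :
    ‖b n‖ + ‖∑' k, a k * b k‖ ≤ M := by
  -- No case split at `x = 0`: there `arg` is 0 and `d = 1`.
  have hrot (x : ℂ) : ∃ d : ℂ, ‖d‖ = 1 ∧ x = ‖x‖ * d :=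
    ⟨Complex.exp (x.arg * Complex.I), Complex.norm_exp_ofReal_mul_I _,
      (Complex.norm_mul_exp_arg_mul_I x).symm⟩
  set S := ∑' k, a k * b k with hS
  obtain ⟨d, hd, hbd⟩ := hrot (b n)
  obtain ⟨e, he, hSe⟩ := hrot S
  have he0 : e ≠ 0 := norm_ne_zero_iff.1 (by simp [he])
  have hc : ‖d / e‖ = 1 := by simp [hd, he]
  have h := norm_coeff_add_tsum_mul_le (a := fun k => d / e * a k) (b := b) (n := n) (M := M)
    (by simpa [hd, he] using ha) hb (fun k hk => by simp [ha0 k hk])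
    (fun ζ hζ => by
      simp only [mul_assoc, tsum_mul_left, norm_mul, hc, one_mul]
      exact hu ζ hζ) hM
  simp only [mul_assoc, tsum_mul_left, ← hS] at h
  have h2 : b n + d / e * S = (‖b n‖ + ‖S‖ : ℝ) * d := by
    conv_lhs => rw [hbd, hSe]
    push_cast
    field_simp
  rwa [h2, norm_mul, hd, mul_one, Complex.norm_real, Real.norm_of_nonneg (by positivity)] at h

theorem discSupNorm_le_ofReal {f : ℂ → ℂ} {M : ℝ}
    (h : ∀ z ∈ Metric.ball (0 : ℂ) 1, ‖f z‖ ≤ M) : discSupNorm f ≤ ENNReal.ofReal M :=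
  iSup₂_le fun z hz => by
    rw [← ofReal_norm]
    exact ENNReal.ofReal_le_ofReal (h z hz)

theorem norm_le_toReal_discSupNorm {f : ℂ → ℂ} (hf : discSupNorm f ≠ ∞) {z : ℂ}
    (hz : z ∈ Metric.ball (0 : ℂ) 1) : ‖f z‖ ≤ (discSupNorm f).toReal := by
  rw [← toReal_enorm]
  exact ENNReal.toReal_mono hf (le_iSup₂ (f := fun z _ => ‖f z‖ₑ) z hz)

theorem taylorCoeff_polynomial_eval (p : ℂ[X]) (k : ℕ) :
    taylorCoeff (fun z => p.eval z) k = p.coeff k := by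
  refine taylorCoeff_eq_of_hasSum (fun z _ => ?_) k
  rw [p.eval_eq_sum_range]
  refine hasSum_sum_of_ne_finset_zero fun j hj => ?_
  rw [p.coeff_eq_zero_of_natDegree_lt (by simpa using hj), zero_mul]

theorem taylorCoeff_sub_polynomial_eval {f : ℂ → ℂ}
    (hf : DifferentiableOn ℂ f (Metric.ball (0 : ℂ) 1)) (p : ℂ[X]) (k : ℕ) :
    taylorCoeff (fun z => f z - p.eval z) k = taylorCoeff f k - p.coeff k := by
  refine taylorCoeff_eq_of_hasSum (c := fun k => taylorCoeff f k - p.coeff k) (fun z hz => ?_) k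
  have hp := hasSum_taylorCoeff (f := fun z => p.eval z) p.differentiable.differentiableOn hz
  simpa only [taylorCoeff_polynomial_eval, sub_mul] using (hasSum_taylorCoeff hf hz).sub hp

/-- Dilating `L` by `z / r` and `g` by `r` makes both series absolutely convergent on the circle,
while the products still carry `z^k`. Letting `r → 1` removes the dilation. -/
theorem norm_taylorCoeff_add_norm_hadamardProd_le {L g : ℂ → ℂ}
    (hL : DifferentiableOn ℂ L (Metric.ball (0 : ℂ) 1))
    (hg : DifferentiableOn ℂ g (Metric.ball (0 : ℂ) 1)) {n : ℕ}
    (hB : ∀ z ∈ Metric.ball (0 : ℂ) 1, ‖L z‖ ≤ (1 / 2 : ℝ) * ‖z‖ ^ (2 * n + 1))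
    (hL0 : ∀ k < 2 * n + 1, taylorCoeff L k = 0) {M : ℝ}
    (hM : ∀ z ∈ Metric.ball (0 : ℂ) 1, ‖g z‖ ≤ M) {z : ℂ} (hz : z ∈ Metric.ball (0 : ℂ) 1) :
    ‖taylorCoeff g n‖ + ‖hadamardProd L g z‖ ≤ M := by
  have hz1 : ‖z‖ < 1 := by simpa using hz
  have key : ∀ r ∈ Set.Ioo ‖z‖ 1, ‖taylorCoeff g n‖ * r ^ n + ‖hadamardProd L g z‖ ≤ M := by
    rintro r ⟨hzr, hr1⟩
    have hr0 : 0 < r := (norm_nonneg z).trans_lt hzr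
    have hrC : (r : ℂ) ≠ 0 := Complex.ofReal_ne_zero.2 hr0.ne'
    have hr : ‖(r : ℂ)‖ = r := by simp [abs_of_pos hr0]
    have hzr1 : ‖z / r‖ < 1 := by rw [norm_div, hr]; exact (div_lt_one hr0).2 hzr
    have hsum (f : ℂ → ℂ) (hf : DifferentiableOn ℂ f (Metric.ball (0 : ℂ) 1)) (w ζ : ℂ)
        (hw : ‖w‖ < 1) (hζ : ‖ζ‖ = 1) : ∑' k, taylorCoeff f k * w ^ k * ζ ^ k = f (w * ζ) := by
      rw [← (hasSum_taylorCoeff hf (z := w * ζ) (by simpa [hζ] using hw)).tsum_eq]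
      simp only [mul_pow, mul_assoc]
    have h := norm_coeff_add_norm_tsum_mul_le (a := fun k => taylorCoeff L k * (z / r) ^ k)
      (b := fun k => taylorCoeff g k * r ^ k) (n := n) (M := M)
      (hasSum_taylorCoeff hL hzr1).summable.norm
      (hasSum_taylorCoeff hg (by rwa [hr])).summable.norm
      (fun k hk => by simp [hL0 k hk])
      (fun ζ hζ => by
        have hw : ‖z / r * ζ‖ < 1 := by simpa [hζ] using hzr1
        rw [hsum L hL _ _ hzr1 hζ]
        refine (hB _ (by simpa using hw)).trans ?_
        have := pow_le_one₀ (n := 2 * n + 1) (norm_nonneg (z / r * ζ)) hw.le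
        linarith)
      (fun ζ hζ => by
        rw [hsum g hg _ _ (by rwa [hr]) hζ]
        exact hM _ (by simpa [hζ, abs_of_pos hr0] using hr1))
    rw [norm_mul, norm_pow, hr] at h
    convert h using 3
    refine tsum_congr fun k => ?_
    rw [div_pow]
    field_simp
  have hlim : Filter.Tendsto (fun r : ℝ => ‖taylorCoeff g n‖ * r ^ n + ‖hadamardProd L g z‖)
      (𝓝[<] 1) (𝓝 (‖taylorCoeff g n‖ * 1 ^ n + ‖hadamardProd L g z‖)) :=
    Filter.Tendsto.mono_left (Continuous.tendsto (by fun_prop) 1) nhdsWithin_le_nhds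
  rw [one_pow, mul_one] at hlim
  exact le_of_tendsto hlim (by filter_upwards [Ioo_mem_nhdsLT hz1] using key)

/-- Subtracting a polynomial of degree below `n` changes neither the `n`-th coefficient nor the
Hadamard product, as `L` has no terms of degree below `n`. -/
theorem enorm_taylorCoeff_add_discSupNorm_le_bestApprox {L f : ℂ → ℂ}
    (hL : DifferentiableOn ℂ L (Metric.ball (0 : ℂ) 1))
    (hf : DifferentiableOn ℂ f (Metric.ball (0 : ℂ) 1)) {n : ℕ}
    (hB : ∀ z ∈ Metric.ball (0 : ℂ) 1, ‖L z‖ ≤ (1 / 2 : ℝ) * ‖z‖ ^ (2 * n + 1)) :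
    ‖taylorCoeff f n‖ₑ + discSupNorm (hadamardProd L f) ≤ bestApprox n f := by
  have hL0 : ∀ k < 2 * n + 1, taylorCoeff L k = 0 := fun k hk =>
    taylorCoeff_eq_zero_of_isBigO (analyticAt_zero_of_differentiableOn_ball hL)
      (IsBigO.of_bound (1 / 2) (by
        filter_upwards [Metric.ball_mem_nhds (0 : ℂ) one_pos] with z hz
        simpa using hB z hz)) hk
  refine le_iInf₂ fun p hp => ?_
  set g : ℂ → ℂ := fun z => f z - p.eval z
  rcases eq_or_ne (discSupNorm g) ∞ with htop | htop
  · simp [htop]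
  have hcoeff : ∀ k, n ≤ k → taylorCoeff g k = taylorCoeff f k := fun k hk => by
    rw [taylorCoeff_sub_polynomial_eval hf, coeff_eq_zero_of_degree_lt
      ((mem_degreeLT.1 hp).trans_le (by exact_mod_cast hk)), sub_zero]
  have hprod : hadamardProd L f = hadamardProd L g := by
    ext z
    refine tsum_congr fun k => ?_
    rcases lt_or_ge k n with hk | hk
    · rw [hL0 k (by omega)]
      simp
    · rw [hcoeff k hk]
  rw [← hcoeff n le_rfl, hprod, discSupNorm, ENNReal.add_biSup ⟨0, by simp⟩]
  refine iSup₂_le fun z hz => ?_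
  rw [← ofReal_norm, ← ofReal_norm,
    ← ENNReal.ofReal_add (norm_nonneg _) (norm_nonneg _)]
  exact ENNReal.ofReal_le_of_le_toReal (norm_taylorCoeff_add_norm_hadamardProd_le hL
    (hf.sub p.differentiable.differentiableOn) hB hL0
    (fun w hw => norm_le_toReal_discSupNorm htop hw) hz)

/-! ### Necessity: test functions -/

theorem norm_taylorCoeff_add_norm_hadamardProd_le_of_forall {n : ℕ} {L : ℂ → ℂ}
    (H : ∀ f : ℂ → ℂ, IsHInfty f →
      ‖taylorCoeff f n‖ₑ + discSupNorm (hadamardProd L f) ≤ bestApprox n f)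
    {f : ℂ → ℂ} (hf : DifferentiableOn ℂ f (Metric.ball (0 : ℂ) 1)) {C : ℝ}
    (hC : ∀ z ∈ Metric.ball (0 : ℂ) 1, ‖f z‖ ≤ C) {p : ℂ[X]} (hp : p ∈ degreeLT ℂ n) {M : ℝ}
    (hM : ∀ z ∈ Metric.ball (0 : ℂ) 1, ‖f z - p.eval z‖ ≤ M) {z : ℂ}
    (hz : z ∈ Metric.ball (0 : ℂ) 1) : ‖taylorCoeff f n‖ + ‖hadamardProd L f z‖ ≤ M := by
  have hM0 : 0 ≤ M := (norm_nonneg _).trans (hM z hz)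
  rw [← ENNReal.ofReal_le_ofReal_iff hM0, ENNReal.ofReal_add (norm_nonneg _) (norm_nonneg _),
    ofReal_norm, ofReal_norm]
  calc _ ≤ ‖taylorCoeff f n‖ₑ + discSupNorm (hadamardProd L f) := by
        gcongr
        exact le_iSup₂ (f := fun z _ => ‖hadamardProd L f z‖ₑ) z hz
    _ ≤ bestApprox n f := H f ⟨hf, (discSupNorm_le_ofReal hC).trans_lt ENNReal.ofReal_lt_top⟩
    _ ≤ discSupNorm fun z => f z - p.eval z := iInf₂_le p hp
    _ ≤ _ := discSupNorm_le_ofReal hM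

/-- For `f = z^n` the term `|f_n| = 1` already exhausts the bound. -/
theorem taylorCoeff_eq_zero_at_degree {n : ℕ} {L : ℂ → ℂ}
    (H : ∀ f : ℂ → ℂ, IsHInfty f →
      ‖taylorCoeff f n‖ₑ + discSupNorm (hadamardProd L f) ≤ bestApprox n f) :
    taylorCoeff L n = 0 := by
  have hb : ∀ z ∈ Metric.ball (0 : ℂ) 1, ‖(X ^ n : ℂ[X]).eval z‖ ≤ 1 := fun z hz => by
    rw [eval_pow, eval_X, norm_pow]
    exact pow_le_one₀ (norm_nonneg z) (mem_ball_zero_iff.1 hz).le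
  have h := norm_taylorCoeff_add_norm_hadamardProd_le_of_forall H
    (f := fun z => (X ^ n : ℂ[X]).eval z) (X ^ n : ℂ[X]).differentiable.differentiableOn hb
    (p := 0) (zero_mem _) (M := 1) (by simpa using hb) (z := 1 / 2)
    (by simp; norm_num)
  have hprod : hadamardProd L (fun z => (X ^ n : ℂ[X]).eval z) (1 / 2) =
      taylorCoeff L n * (1 / 2) ^ n := by
    rw [hadamardProd, tsum_eq_single n]
    · rw [taylorCoeff_polynomial_eval, coeff_X_pow, if_pos rfl, mul_one]
    · intro k hk
      rw [taylorCoeff_polynomial_eval, coeff_X_pow, if_neg hk]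
      simp
  rw [hprod, taylorCoeff_polynomial_eval, coeff_X_pow, if_pos rfl, norm_one] at h
  have h0 : ‖taylorCoeff L n * (1 / 2) ^ n‖ = 0 := le_antisymm (by linarith) (norm_nonneg _)
  simpa using h0

/-- On `|w| = 1` the perturbation `w² - 1 = 2i (Im w) w` is orthogonal to `w`, so the effect is of
second order. Inside the disc the cross term is `-2ε (Re w)(1 - |w|²)`, absorbed by `e1`. -/
theorem norm_add_mul_sq_sub_one_le {w : ℂ} (hw : ‖w‖ ≤ 1) {ε : ℝ} (h0 : 0 ≤ ε) (h1 : ε ≤ 1 / 2) :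
    ‖w + ε * (w ^ 2 - 1)‖ ≤ 1 + 2 * ε ^ 2 := by
  refine abs_le_of_sq_le_sq' ?_ (by positivity) |>.2
  have hsq : w.re ^ 2 + w.im ^ 2 ≤ 1 := by
    have : ‖w‖ ^ 2 ≤ 1 := pow_le_one₀ (norm_nonneg w) hw
    rwa [Complex.sq_norm, Complex.normSq_apply, ← sq, ← sq] at this
  rw [Complex.sq_norm, Complex.normSq_apply]
  simp only [Complex.add_re, Complex.add_im, Complex.ofReal_re, Complex.ofReal_im, Complex.sub_re,
    Complex.sub_im, Complex.one_re, Complex.one_im, sq w, Complex.mul_re, Complex.mul_im, zero_mul,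
    sub_zero, add_zero]
  set x := w.re
  set y := w.im
  have hx : -1 ≤ x := by nlinarith
  have e1 : 0 ≤ (1 - x ^ 2 - y ^ 2) * (1 + 2 * ε * x) :=
    mul_nonneg (by linarith) (by nlinarith [mul_nonneg h0 (neg_le_iff_add_nonneg.1 hx)])
  have e2 : 0 ≤ ε ^ 2 * (4 - ((x * x - y * y - 1) ^ 2 + (x * y + y * x) ^ 2)) :=
    mul_nonneg (by positivity) (by nlinarith [sq_nonneg x, sq_nonneg y])
  nlinarith [sq_nonneg (ε ^ 2)]

/-- Approximating `z^n + ε z^{n+k}` by `ε z^{n-k}` leaves `z^{n-k}(w + ε(w² - 1))` with `w = z^k`,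
of norm at most `1 + 2ε²`. The gain on the left is linear in `ε`, so its coefficient must vanish. -/
theorem taylorCoeff_degree_add_eq_zero {n : ℕ} {L : ℂ → ℂ}
    (H : ∀ f : ℂ → ℂ, IsHInfty f →
      ‖taylorCoeff f n‖ₑ + discSupNorm (hadamardProd L f) ≤ bestApprox n f)
    {k : ℕ} (hk0 : k ≠ 0) (hkn : k ≤ n) : taylorCoeff L (n + k) = 0 := by
  have hbound : ∀ ε ∈ Set.Ioo (0 : ℝ) (1 / 2),
      ‖taylorCoeff L (n + k) * (1 / 2) ^ (n + k)‖ ≤ 2 * ε := by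
    rintro ε ⟨h0, h1⟩
    set p : ℂ[X] := X ^ n + C (ε : ℂ) * X ^ (n + k) with hp
    have hcoeff (j : ℕ) : taylorCoeff (fun z => p.eval z) j =
        (if j = n then 1 else 0) + if j = n + k then (ε : ℂ) else 0 := by
      rw [taylorCoeff_polynomial_eval, hp, coeff_add, coeff_X_pow, coeff_C_mul, coeff_X_pow]
      simp
    have hq : C (ε : ℂ) * X ^ (n - k) ∈ degreeLT ℂ n := mem_degreeLT.2
      ((degree_C_mul_X_pow_le _ _).trans_lt (by exact_mod_cast (by omega : n - k < n)))
    have h := norm_taylorCoeff_add_norm_hadamardProd_le_of_forall H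
      (f := fun z => p.eval z) p.differentiable.differentiableOn (C := 1 + ε * 1)
      (fun z hz => by
        have hz1 : ‖z‖ ≤ 1 := (mem_ball_zero_iff.1 hz).le
        simp only [hp, eval_add, eval_mul, eval_C, eval_pow, eval_X]
        refine (norm_add_le _ _).trans (add_le_add ?_ ?_)
        · rw [norm_pow]
          exact pow_le_one₀ (norm_nonneg z) hz1
        · rw [norm_mul, norm_pow, Complex.norm_real, Real.norm_of_nonneg h0.le]
          exact mul_le_mul_of_nonneg_left (pow_le_one₀ (norm_nonneg z) hz1) h0.le)
      hq (M := 1 + 2 * ε ^ 2)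
      (fun z hz => by
        have hz1 : ‖z‖ ≤ 1 := (mem_ball_zero_iff.1 hz).le
        have hfac : p.eval z - (C (ε : ℂ) * X ^ (n - k)).eval z =
            z ^ (n - k) * (z ^ k + ε * ((z ^ k) ^ 2 - 1)) := by
          obtain ⟨m, rfl⟩ := Nat.exists_eq_add_of_le' hkn
          simp only [hp, eval_add, eval_mul, eval_C, eval_pow, eval_X, Nat.add_sub_cancel]
          ring
        rw [hfac, norm_mul, norm_pow]
        refine (mul_le_of_le_one_left (norm_nonneg _)
          (pow_le_one₀ (norm_nonneg z) hz1)).trans (norm_add_mul_sq_sub_one_le ?_ h0.le h1.le)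
        rw [norm_pow]
        exact pow_le_one₀ (norm_nonneg z) hz1)
      (z := 1 / 2) (by simp; norm_num)
    have hprod : hadamardProd L (fun z => p.eval z) (1 / 2) =
        ε * (taylorCoeff L (n + k) * (1 / 2) ^ (n + k)) := by
      rw [hadamardProd, tsum_eq_single (n + k)]
      · rw [hcoeff, if_neg (by omega), if_pos rfl]
        ring
      · intro j hj
        rw [hcoeff, if_neg hj]
        rcases eq_or_ne j n with rfl | hjn
        · simp [taylorCoeff_eq_zero_at_degree H]
        · simp [hjn]
    rw [hprod, hcoeff, if_pos rfl, if_neg (by omega), add_zero, norm_one, norm_mul,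
      Complex.norm_real, Real.norm_of_nonneg h0.le] at h
    exact le_of_mul_le_mul_left (by linarith) h0
  have hlim : Filter.Tendsto (fun ε : ℝ => 2 * ε) (𝓝[>] 0) (𝓝 (2 * 0)) :=
    Filter.Tendsto.mono_left (Continuous.tendsto (by fun_prop) 0) nhdsWithin_le_nhds
  have h0 := ge_of_tendsto hlim
    (by filter_upwards [Ioo_mem_nhdsGT (show (0 : ℝ) < 1 / 2 by norm_num)] using hbound)
  rw [mul_zero, norm_le_zero_iff] at h0
  simpa using h0

/-- The difference of the squares is `(1 - a²)(1 - |z|²)`. -/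
theorem norm_sub_le_norm_one_sub_mul {z : ℂ} (hz : ‖z‖ ≤ 1) {a : ℝ} (h0 : 0 ≤ a) (h1 : a ≤ 1) :
    ‖z - a‖ ≤ ‖1 - a * z‖ := by
  refine abs_le_of_sq_le_sq' ?_ (norm_nonneg _) |>.2
  have hsq : z.re ^ 2 + z.im ^ 2 ≤ 1 := by
    have : ‖z‖ ^ 2 ≤ 1 := pow_le_one₀ (norm_nonneg z) hz
    rwa [Complex.sq_norm, Complex.normSq_apply, ← sq, ← sq] at this
  rw [Complex.sq_norm, Complex.normSq_apply, Complex.sq_norm, Complex.normSq_apply]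
  simp only [Complex.sub_re, Complex.sub_im, Complex.ofReal_re, Complex.ofReal_im,
    Complex.re_ofReal_mul, Complex.im_ofReal_mul, Complex.one_re, Complex.one_im]
  nlinarith [mul_nonneg (show 0 ≤ 1 - a ^ 2 by nlinarith) (sub_nonneg.2 hsq)]

theorem norm_le_half_of_forall {n : ℕ} {L : ℂ → ℂ}
    (hL : DifferentiableOn ℂ L (Metric.ball (0 : ℂ) 1))
    (H : ∀ f : ℂ → ℂ, IsHInfty f →
      ‖taylorCoeff f n‖ₑ + discSupNorm (hadamardProd L f) ≤ bestApprox n f)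
    (hL0 : ∀ k < n + 1, taylorCoeff L k = 0) {z : ℂ} (hz : z ∈ Metric.ball (0 : ℂ) 1) :
    ‖L z‖ ≤ 1 / 2 := by
  have key : ∀ a ∈ Set.Ioo (0 : ℝ) 1, (1 + a) * ‖L (a * z)‖ ≤ a ^ (n + 1) := by
    rintro a ⟨ha0, ha1⟩
    have haC : (a : ℂ) ≠ 0 := Complex.ofReal_ne_zero.2 ha0.ne'
    have hna : ‖(a : ℂ)‖ = a := by simp [abs_of_pos ha0]
    have haz (w : ℂ) (hw : ‖w‖ < 1) : ‖(a : ℂ) * w‖ < 1 := by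
      rw [norm_mul, hna]
      nlinarith [norm_nonneg w]
    have hne (w : ℂ) (hw : ‖w‖ < 1) : 1 - (a : ℂ) * w ≠ 0 := fun h => by
      have := haz w hw
      rw [← sub_eq_zero.1 h, norm_one] at this
      exact this.false
    set f : ℂ → ℂ := fun w => w ^ n * ((w - a) / (1 - a * w)) with hf_def
    -- From `(w - a)/(1 - aw) = -a + (1 - a²) w/(1 - aw)`.
    set c : ℕ → ℂ := fun k => if k < n then 0 else if k = n then -(a : ℂ) else
      (1 - a ^ 2) * a ^ (k - (n + 1)) with hc_def
    have hfd : DifferentiableOn ℂ f (Metric.ball (0 : ℂ) 1) := fun w hw => by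
      have := hne w (by simpa using hw)
      exact DifferentiableAt.differentiableWithinAt (by fun_prop (disch := assumption))
    have hcoeff (k : ℕ) : taylorCoeff f k = c k := by
      refine taylorCoeff_eq_of_hasSum (fun w hw => ?_) k
      have hgeom := (hasSum_geometric_of_norm_lt_one (haz w hw)).mul_left
        ((1 - (a : ℂ) ^ 2) * w ^ (n + 1))
      have hshift : HasSum (fun j => c (j + (n + 1)) * w ^ (j + (n + 1)))
          ((1 - (a : ℂ) ^ 2) * w ^ (n + 1) * (1 - a * w)⁻¹) := by
        refine hgeom.congr_fun fun j => ?_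
        simp only [hc_def, if_neg (show ¬ j + (n + 1) < n by omega),
          if_neg (show ¬ j + (n + 1) = n by omega), Nat.add_sub_cancel]
        ring
      rw [hasSum_nat_add_iff (f := fun j => c j * w ^ j) (n + 1)] at hshift
      have hfw : f w = (1 - (a : ℂ) ^ 2) * w ^ (n + 1) * (1 - a * w)⁻¹ +
          ∑ j ∈ Finset.range (n + 1), c j * w ^ j := by
        rw [Finset.sum_range_succ, Finset.sum_eq_zero fun j hj => by
          simp [hc_def, Finset.mem_range.1 hj]]
        simp only [hc_def, hf_def, lt_irrefl, if_true, if_false]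
        rw [div_eq_mul_inv]
        linear_combination (-(w ^ n * a)) * mul_inv_cancel₀ (hne w hw)
      rwa [hfw]
    have hfb : ∀ w ∈ Metric.ball (0 : ℂ) 1, ‖f w‖ ≤ 1 := fun w hw => by
      have hw1 : ‖w‖ ≤ 1 := (mem_ball_zero_iff.1 hw).le
      rw [hf_def, norm_mul, norm_pow, norm_div]
      exact mul_le_one₀ (pow_le_one₀ (norm_nonneg w) hw1) (by positivity)
        (div_le_one_of_le₀ (norm_sub_le_norm_one_sub_mul hw1 ha0.le ha1.le) (norm_nonneg _))
    -- Beyond degree `n` the coefficients are geometric, so convolution is a dilation; `L` has no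
    -- terms of degree at most `n`.
    have hprod : hadamardProd L f z = (1 - a ^ 2) / a ^ (n + 1) * L (a * z) := by
      rw [← (hasSum_taylorCoeff hL (haz z (by simpa using hz))).tsum_eq, ← tsum_mul_left]
      refine tsum_congr fun k => ?_
      rcases lt_or_ge k (n + 1) with hk | hk
      · simp [hL0 k hk]
      · obtain ⟨j, rfl⟩ := Nat.exists_eq_add_of_le' hk
        rw [hcoeff]
        simp only [hc_def, if_neg (show ¬ j + (n + 1) < n by omega),
          if_neg (show ¬ j + (n + 1) = n by omega), Nat.add_sub_cancel]
        field_simp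
        ring
    have h := norm_taylorCoeff_add_norm_hadamardProd_le_of_forall H hfd hfb (p := 0)
      (zero_mem _) (M := 1) (by simpa using hfb) hz
    have hn : ‖((1 - a ^ 2) / a ^ (n + 1) : ℂ)‖ = (1 - a ^ 2) / a ^ (n + 1) := by
      rw [← Complex.ofReal_one, ← Complex.ofReal_pow, ← Complex.ofReal_pow, ← Complex.ofReal_sub,
        ← Complex.ofReal_div, Complex.norm_real, Real.norm_of_nonneg]
      exact div_nonneg (by nlinarith) (by positivity)
    have hcn : ‖c n‖ = a := by simp [hc_def, abs_of_pos ha0]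
    rw [hcoeff, hcn, hprod, norm_mul, hn] at h
    -- The slack `1 - |f_n| = 1 - a` cancels a factor of `1 - a²`; the remaining `1 + a → 2` yields
    -- the constant `1/2`.
    have h2 : (1 - a) * ((1 + a) * ‖L (a * z)‖ / a ^ (n + 1)) ≤ (1 - a) * 1 := by
      calc _ = (1 - a ^ 2) / a ^ (n + 1) * ‖L (a * z)‖ := by ring
        _ ≤ _ := by linarith
    have h3 := le_of_mul_le_mul_left h2 (by linarith)
    rwa [div_le_one (by positivity)] at h3
  have hcont : ContinuousAt L ((1 : ℝ) * z) := by
    rw [Complex.ofReal_one, one_mul]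
    exact hL.continuousOn.continuousAt (Metric.isOpen_ball.mem_nhds hz)
  have hlim1 : Filter.Tendsto (fun a : ℝ => (1 + a) * ‖L (a * z)‖) (𝓝[<] 1)
      (𝓝 ((1 + 1) * ‖L ((1 : ℝ) * z)‖)) := by
    refine Filter.Tendsto.mono_left ?_ nhdsWithin_le_nhds
    have h1 : Filter.Tendsto (fun a : ℝ => (a : ℂ) * z) (𝓝 1) (𝓝 ((1 : ℝ) * z)) :=
      Continuous.tendsto (by fun_prop) 1
    exact (tendsto_const_nhds.add Filter.tendsto_id).mul (hcont.tendsto.comp h1).norm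
  have hlim2 : Filter.Tendsto (fun a : ℝ => a ^ (n + 1)) (𝓝[<] 1) (𝓝 (1 ^ (n + 1))) :=
    Filter.Tendsto.mono_left (Continuous.tendsto (by fun_prop) 1) nhdsWithin_le_nhds
  have := le_of_tendsto_of_tendsto hlim1 hlim2
    (by filter_upwards [Ioo_mem_nhdsLT (zero_lt_one' ℝ)] using key)
  rw [Complex.ofReal_one, one_mul, one_pow] at this
  linarith

/-! ### The equivalence -/

theorem theorem3 (n : ℕ) (L : ℂ → ℂ)
    (hL : DifferentiableOn ℂ L (Metric.ball (0 : ℂ) 1))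
    (hL0 : L =O[𝓝 0] fun z : ℂ => z ^ n) :
    (∀ f : ℂ → ℂ, IsHInfty f →
        ‖taylorCoeff f n‖ₑ + discSupNorm (hadamardProd L f) ≤ bestApprox n f) ↔
      ∀ z ∈ Metric.ball (0 : ℂ) 1, ‖L z‖ ≤ (1 / 2 : ℝ) * ‖z‖ ^ (2 * n + 1) := by
  refine ⟨fun H => ?_, fun hB f hf => enorm_taylorCoeff_add_discSupNorm_le_bestApprox hL hf.1 hB⟩
  have hcoeff : ∀ k < 2 * n + 1, taylorCoeff L k = 0 := by
    intro k hk
    rcases lt_trichotomy k n with hkn | rfl | hkn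
    · exact taylorCoeff_eq_zero_of_isBigO (analyticAt_zero_of_differentiableOn_ball hL) hL0 hkn
    · exact taylorCoeff_eq_zero_at_degree H
    · rw [← Nat.add_sub_cancel' hkn.le]
      exact taylorCoeff_degree_add_eq_zero H (by omega) (by omega)
  exact fun z hz => norm_le_mul_pow_of_taylorCoeff_eq_zero hL
    (fun w hw => norm_le_half_of_forall hL H (fun k hk => hcoeff k (by omega)) hw) hcoeff hz
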